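/- **Setting.** Let $X$ be a surface word: a cyclic sequence in which each of the symbols $s_1,\dots,s_g,S_1,\dots,S_g$ appears exactly once; write $s_i^{-1}=S_i$, $S_i^{-1}=s_i$. The symbols label, clockwise in the order of $X$, edges of a polygon, and the edges $x$ and $x^{-1}$ are glued so that an orientable surface with boundary results. Let $x_0x_1\cdots x_{n-1}$ ($n\ge 1$, indices mod $n$) be a reduced cyclic word in these symbols, i.e. $x_{t+1}\ne x_t^{-1}$ for all $t$. A segmented representative in general position is encoded by two cyclic lists. The *point list* $P$ runs clockwise through the points on the edges, edge by edge in the order of $X$; the edge $x$ carries distinct points labelled $(x,1),\dots,(x,c)$ in some order, where $c$ is the number of $t$ with $x_t\in\{x,x^{-1}\}$, and the points $(x^{-1},i)=(x,i)^{-1}$ occur on the edge $x^{-1}$ in the reverse order. The *segment list* $C=W_0W_1\cdots W_{n-1}$ consists of *word segments* $W_t=(w_{t,1},w_{t,2})$, pairs of points of $P$, such that $w_{t,2}$ lies on the edge $x_t$, $w_{t+1,1}=w_{t,2}^{-1}$, and the $2n$ endpoints $w_{t,1},w_{t,2}$ are distinct. Two word segments *intersect* if the endpoints of one separate those of the other in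 the cyclic list $P$. A *combinatorial bigon* of length $L\ge 2$ and orientation $(+,+)$, respectively $(+,-)$, consists of two sequences of word segments (*legs*) $A_0,\dots,A_{L-1}$ and $B_0,\dots,B_{L-1}$, where $A_m=W_{k+m}$, and $B_m=W_{l+m}$, respectively $B_m=W_{l-m}$, such that $A_0$ intersects $B_0$, $A_{L-1}$ intersects $B_{L-1}$, $A_m$ does not intersect $B_m$ for $0<m<L-1$, and for each $0\le m<L-1$ the pair $A_m,B_m$ does not split: the terminal point of $A_m$ lies on the same edge as the terminal point of $B_m$, respectively as the initial point of $B_m$. A word segment is *shared* if it occurs in both legs. **Proposition.** For every combinatorial bigon: (a) If exactly one word segment is shared, it is the first word segment of one leg and the last word segment of the other. (b) If exactly two word segments are shared, then either they are the first two word segments of one leg and, in the same order, the last two of the other, or they are the first and last word segments of both legs, with $A_0=B_{L-1}$ and $A_{L-1}=B_0$. (c) If at least three word segments are shared, then at least two initial word segments of one leg coincide with the final word segments of the other: there is an $r$ with $2\le r\le L$ such that the first $r$ word segments of one leg are, in the same order, the last $r$ word segments of the other. -/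

import Mathlib

/-- The symbols `s_a` (written `(a, true)`) and `S_a` (written `(a, false)`), `a : α`. -/
abbrev Letter (α : Type*) := α × Bool

/-- The inverse symbol: `s_a` and `S_a` are exchanged. -/
def Letter.inv {α : Type*} (x : Letter α) : Letter α := (x.1, !x.2)

/-- A labelled point: `(x, i)` is the point with label `x_i` on the edge `x` of the polygon. -/
abbrev LPoint (α : Type*) := Letter α × ℕ

/-- The edge of the polygon on which a point lies. -/
def LPoint.edge {α : Type*} (p : LPoint α) : Letter α := p.1

/-- The inverse point: same index, inverse letter (`a_i` and `A_i` are the same point of the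
surface). -/
def LPoint.inv {α : Type*} (p : LPoint α) : LPoint α := (Letter.inv p.1, p.2)

/-- A word segment: an ordered pair of points, (initial point, terminal point). -/
abbrev WordSegment (α : Type*) := LPoint α × LPoint α

/-- A surface word: a cyclic sequence in which every symbol appears exactly once, given by the
list that one reads clockwise from an arbitrarily chosen first symbol. -/
structure SurfaceWord (α : Type*) where
  letters : List (Letter α)
  nodup : letters.Nodup
  complete : ∀ x : Letter α, x ∈ letters

/-- A reduced cyclic word of length `n`: no letter is cyclically followed by its inverse. -/
structure ReducedCyclicWord (α : Type*) (n : ℕ) where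
  letter : ZMod n → Letter α
  reduced : ∀ t : ZMod n, letter (t + 1) ≠ Letter.inv (letter t)

/-- The number of appearances of the symbol `x` and of its inverse in the cyclic word `w`. -/
def ReducedCyclicWord.count {α : Type*} [DecidableEq α] {n : ℕ} [NeZero n]
    (w : ReducedCyclicWord α n) (x : Letter α) : ℕ :=
  (Finset.univ.filter fun t : ZMod n => w.letter t = x ∨ w.letter t = Letter.inv x).card

/-- The combinatorial data `(P, C)` of a segmented representative, in general position, of the
reduced cyclic word `w` on the polygon of the surface word `X`.

`block x` is the clockwise list of the points on the edge `x`; the point list `P` is the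
concatenation of the blocks along `X` (see `pointList`). The edges `x` and `x⁻¹` are glued so as
to preserve orientability, whence the reversal in `block_inv`. `C` is the segment list: `C t` is
the `t`-th word segment `W_t = (w_{t,1}, w_{t,2})`, which leaves the polygon through the edge named
by the `t`-th letter of the word, and the curve continues at the glued point. The endpoints of all
segments are distinct (so, by counting, every point of `P` is an endpoint of exactly one of
them). -/
structure SegmentedRep {α : Type*} [DecidableEq α] {n : ℕ} [NeZero n]
    (X : SurfaceWord α) (w : ReducedCyclicWord α n) where
  block : Letter α → List (LPoint α)
  block_nodup : ∀ x, (block x).Nodup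
  mem_block : ∀ x p, p ∈ block x ↔ p.edge = x ∧ 1 ≤ p.2 ∧ p.2 ≤ w.count x
  block_inv : ∀ x, block (Letter.inv x) = ((block x).map LPoint.inv).reverse
  C : ZMod n → WordSegment α
  terminal_mem : ∀ t, (C t).2 ∈ block (w.letter t)
  initial_succ : ∀ t, (C (t + 1)).1 = LPoint.inv (C t).2
  initial_injective : Function.Injective fun t => (C t).1
  terminal_injective : Function.Injective fun t => (C t).2
  initial_ne_terminal : ∀ s t, (C s).1 ≠ (C t).2

/-- The two orientations of a pair of traced sequences: `(+,+)` and `(+,-)`. -/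
inductive BigonOrientation where
  | plusPlus
  | plusMinus

namespace SegmentedRep

variable {α : Type*} [DecidableEq α] {n : ℕ} [NeZero n] {X : SurfaceWord α}
  {w : ReducedCyclicWord α n}

/-- The point list `P`: all points in clockwise order around the polygon. It is a cyclic list,
represented by the list that starts with the first edge of `X`. -/
def pointList (R : SegmentedRep X w) : List (LPoint α) := X.letters.flatMap R.block

/-- The position of a point in the point list. -/
def pos (R : SegmentedRep X w) (p : LPoint α) : ℕ := R.pointList.idxOf p

/-- `x` lies on the open arc between `a` and `b` that does not contain the cut of the cyclic
list `P`. -/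
def Inside (R : SegmentedRep X w) (a b x : LPoint α) : Prop :=
  min (R.pos a) (R.pos b) < R.pos x ∧ R.pos x < max (R.pos a) (R.pos b)

/-- `x` lies on the other open arc between `a` and `b`. -/
def Outside (R : SegmentedRep X w) (a b x : LPoint α) : Prop :=
  R.pos x < min (R.pos a) (R.pos b) ∨ max (R.pos a) (R.pos b) < R.pos x

/-- The segments `S` and `T` intersect: the endpoints of `S` separate the endpoints of `T` in the
cyclic list `P`. -/
def Intersects (R : SegmentedRep X w) (S T : WordSegment α) : Prop :=
  (R.Inside S.1 S.2 T.1 ∧ R.Outside S.1 S.2 T.2) ∨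
    (R.Outside S.1 S.2 T.1 ∧ R.Inside S.1 S.2 T.2)

/-- The `m`-th segment (from `m = 0`) of the first leg, `W_{k+m}`. -/
def leg₁ (R : SegmentedRep X w) (k : ZMod n) (m : ℕ) : WordSegment α := R.C (k + m)

/-- The `m`-th segment (from `m = 0`) of the second leg, `W_{l+m}` or `W_{l-m}` according to the
orientation. -/
def leg₂ (R : SegmentedRep X w) (o : BigonOrientation) (l : ZMod n) (m : ℕ) : WordSegment α :=
  match o with
  | .plusPlus => R.C (l + m)
  | .plusMinus => R.C (l - m)

/-- The edge through which the `m`-th segment of the first leg leaves the polygon. -/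
def exitEdge₁ (R : SegmentedRep X w) (k : ZMod n) (m : ℕ) : Letter α := (R.leg₁ k m).2.edge

/-- The edge through which the `m`-th segment of the second leg leaves the polygon when it is
traced in the direction given by the orientation. -/
def exitEdge₂ (R : SegmentedRep X w) (o : BigonOrientation) (l : ZMod n) (m : ℕ) : Letter α :=
  match o with
  | .plusPlus => (R.leg₂ o l m).2.edge
  | .plusMinus => (R.leg₂ o l m).1.edge

/-- The combinatorial bigon with legs `W_k, W_{k+1}, …` and `W_l, W_{l±1}, …` of length `L`: it
starts with an intersecting pair, the traced pairs do not split to different edges, and `L - 1` is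
the first positive number of steps after which the traced pair intersects again. -/
structure IsCombinatorialBigon (R : SegmentedRep X w) (o : BigonOrientation) (k l : ZMod n)
    (L : ℕ) : Prop where
  two_le : 2 ≤ L
  first_intersects : R.Intersects (R.leg₁ k 0) (R.leg₂ o l 0)
  last_intersects : R.Intersects (R.leg₁ k (L - 1)) (R.leg₂ o l (L - 1))
  not_intersects : ∀ m, 0 < m → m < L - 1 → ¬ R.Intersects (R.leg₁ k m) (R.leg₂ o l m)
  not_split : ∀ m, m < L - 1 → R.exitEdge₁ k m = R.exitEdge₂ o l m

/-- The set of the word segments that occur in both legs. -/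
def sharedSegments (R : SegmentedRep X w) (o : BigonOrientation) (k l : ZMod n) (L : ℕ) :
    Finset (WordSegment α) :=
  (Finset.range L).image (R.leg₁ k) ∩ (Finset.range L).image (R.leg₂ o l)

end SegmentedRep

/-! Of intersection, only irreflexivity and symmetry are used; the rest is index arithmetic modulo
`n`. For `(+,-)` nothing is shared: legs tracing a common segment in opposite directions meet
halfway, where the word would fail to be reduced, a letter would equal its inverse, or a segment
would intersect itself (`leg₁_ne_leg₂_plusMinus`). For `(+,+)` the second leg is the first one
shifted by `d = (l - k).val`, with `0 < d < n` and `L ≤ n + 1`. The end of the first leg overlaps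
the start of the second in `L - d` segments, and the start of the first overlaps the end of the
second in `L + d - n` (truncated at `0`). The shared segments number the sum of these, capped at `n`
(`card_sharedSegments_plusPlus`); the three claims follow from how 1, 2 or at least 3 splits into
two summands. -/

theorem Letter.inv_ne {α : Type*} (x : Letter α) : Letter.inv x ≠ x := by
  intro h
  have := congrArg Prod.snd h
  simp [Letter.inv] at this

namespace SegmentedRep

section Basic

variable {α : Type*} [DecidableEq α] {n : ℕ} [NeZero n] {X : SurfaceWord α}
  {w : ReducedCyclicWord α n} (R : SegmentedRep X w)

/-! ### Intersections, edges and the orientation `(+,-)`. -/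

theorem not_intersects_self (S : WordSegment α) : ¬ R.Intersects S S := by
  unfold Intersects Inside Outside
  omega

theorem Intersects.symm {R : SegmentedRep X w} {S T : WordSegment α} (h : R.Intersects S T) :
    R.Intersects T S := by
  unfold Intersects Inside Outside at *
  omega

theorem C_injective : Function.Injective R.C := fun _ _ h =>
  R.terminal_injective (congrArg Prod.snd h)

theorem terminal_edge (t : ZMod n) : (R.C t).2.edge = w.letter t :=
  ((R.mem_block _ _).1 (R.terminal_mem t)).1

theorem initial_edge_succ (t : ZMod n) : (R.C (t + 1)).1.edge = Letter.inv (w.letter t) := by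
  rw [R.initial_succ, ← R.terminal_edge]
  rfl

/-- This is where reducedness of the word enters. -/
theorem terminal_edge_ne_initial_edge (t : ZMod n) : (R.C t).2.edge ≠ (R.C t).1.edge := by
  have h := R.initial_edge_succ (t - 1)
  have h' := w.reduced (t - 1)
  rw [sub_add_cancel] at h h'
  rw [h, R.terminal_edge]
  exact h'

theorem terminal_edge_ne_initial_edge_succ (t : ZMod n) :
    (R.C t).2.edge ≠ (R.C (t + 1)).1.edge := by
  rw [R.initial_edge_succ, R.terminal_edge]
  exact (Letter.inv_ne _).symm

/-- The legs of a bigon with orientation `(+,-)` have no common segment: two oppositely traced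
passages through a common segment would meet halfway, where the curve would have to turn back. -/
theorem IsCombinatorialBigon.leg₁_ne_leg₂_plusMinus {R : SegmentedRep X w} {k l : ZMod n} {L : ℕ}
    (hB : R.IsCombinatorialBigon .plusMinus k l L) {i j : ℕ} (hi : i < L) (hj : j < L) :
    R.leg₁ k i ≠ R.leg₂ .plusMinus l j := by
  intro h
  have hl : l = k + ((i + j : ℕ) : ZMod n) := by
    have h' : k + (i : ZMod n) = l - j := R.C_injective h
    push_cast
    linear_combination -h'
  -- Since `l = k + (i + j)`, the legs are at the same segment (`i + j` even) or at consecutive ones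
  -- (`i + j` odd) at this midpoint.
  have hsplit := hB.not_split ((i + j) / 2)
  rcases Nat.even_or_odd' (i + j) with ⟨m, hm | hm⟩
  · rw [hm] at hl hsplit
    rw [Nat.mul_div_cancel_left m (by norm_num)] at hsplit
    have hseg : R.leg₁ k m = R.leg₂ .plusMinus l m := by
      simp only [leg₁, leg₂, hl]
      congr 1
      push_cast
      ring
    by_cases hmL : m < L - 1
    · have he := hsplit hmL
      simp only [exitEdge₁, exitEdge₂, ← hseg] at he
      exact R.terminal_edge_ne_initial_edge _ he
    -- Here `i = j = L - 1`: no non-splitting condition is available, but the last pair is a segment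
    -- with itself.
    · have hlast := hB.last_intersects
      rw [show L - 1 = m by omega, hseg] at hlast
      exact R.not_intersects_self _ hlast
  · rw [hm] at hl hsplit
    rw [show (2 * m + 1) / 2 = m by omega] at hsplit
    have he := hsplit (by omega)
    simp only [exitEdge₁, exitEdge₂, leg₁, leg₂, hl] at he
    refine R.terminal_edge_ne_initial_edge_succ (k + m) (he.trans ?_)
    congr 3
    push_cast
    ring

theorem IsCombinatorialBigon.sharedSegments_plusMinus {R : SegmentedRep X w} {k l : ZMod n}
    {L : ℕ} (hB : R.IsCombinatorialBigon .plusMinus k l L) :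
    R.sharedSegments .plusMinus k l L = ∅ := by
  refine Finset.eq_empty_of_forall_notMem fun S hS => ?_
  simp only [sharedSegments, Finset.mem_inter, Finset.mem_image, Finset.mem_range] at hS
  obtain ⟨⟨i, hi, hiS⟩, j, hj, hjS⟩ := hS
  exact hB.leg₁_ne_leg₂_plusMinus hi hj (hiS.trans hjS.symm)

/-! ### Index arithmetic for orientation `(+,+)`. -/

theorem leg₁_injOn (k : ZMod n) : Set.InjOn (R.leg₁ k) (Set.Iio n) := by
  intro i hi j hj h
  have h' : k + (i : ZMod n) = k + j := R.C_injective h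
  have h'' := (ZMod.natCast_eq_natCast_iff' i j n).1 (add_left_cancel h')
  rwa [Nat.mod_eq_of_lt hi, Nat.mod_eq_of_lt hj] at h''

theorem leg₁_eq_leg₂_plusPlus_iff (k l : ZMod n) (i j : ℕ) :
    R.leg₁ k i = R.leg₂ .plusPlus l j ↔ i ≡ (l - k).val + j [MOD n] := by
  rw [← ZMod.natCast_eq_natCast_iff, Nat.cast_add, ZMod.natCast_zmod_val]
  refine ⟨fun h => ?_, fun h => ?_⟩
  · have h' : k + (i : ZMod n) = l + j := R.C_injective h
    linear_combination h'
  · simp only [leg₁, leg₂, h]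
    congr 1
    ring

theorem leg₁_val_add (k l : ZMod n) (m : ℕ) :
    R.leg₁ k ((l - k).val + m) = R.leg₂ .plusPlus l m :=
  (R.leg₁_eq_leg₂_plusPlus_iff k l _ _).2 rfl

theorem leg₁_eq_leg₂_sub_val_add (k l : ZMod n) (m : ℕ) :
    R.leg₁ k m = R.leg₂ .plusPlus l (n - (l - k).val + m) := by
  refine (R.leg₁_eq_leg₂_plusPlus_iff k l _ _).2 ?_
  have := ZMod.val_lt (l - k)
  rw [← add_assoc, Nat.add_sub_cancel' this.le]
  simp [Nat.ModEq]

theorem leg₁_add_period (k : ZMod n) (m : ℕ) : R.leg₁ k (n + m) = R.leg₁ k m := by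
  simp [leg₁]

theorem leg₂_plusPlus_add_period (l : ZMod n) (m : ℕ) :
    R.leg₂ .plusPlus l (n + m) = R.leg₂ .plusPlus l m := by
  simp [leg₂]

namespace IsCombinatorialBigon

variable {R} {k l : ZMod n} {L : ℕ}

/-- After `n` steps the initial intersecting pair recurs, so the bigon has ended by then. -/
theorem length_le (hB : R.IsCombinatorialBigon .plusPlus k l L) : L ≤ n + 1 := by
  by_contra! h
  refine hB.not_intersects n (NeZero.pos n) (by omega) ?_
  have h1 := R.leg₁_add_period k 0
  have h2 := R.leg₂_plusPlus_add_period l 0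
  rw [add_zero] at h1 h2
  rw [h1, h2]
  exact hB.first_intersects

theorem val_sub_pos (hB : R.IsCombinatorialBigon .plusPlus k l L) : 0 < (l - k).val := by
  refine Nat.pos_of_ne_zero fun h => R.not_intersects_self (R.leg₁ k 0) ?_
  have h0 := R.leg₁_val_add k l 0
  rw [h] at h0
  nth_rewrite 2 [h0]
  exact hB.first_intersects

/-- The common segments of the legs of a bigon with orientation `(+,+)`, each listed once by its
position on the first leg. -/
theorem sharedSegments_plusPlus (hB : R.IsCombinatorialBigon .plusPlus k l L) :
    R.sharedSegments .plusPlus k l L =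
      ((Finset.range (min L n)).filter
        fun i => (l - k).val ≤ i ∨ i < L + (l - k).val - n).image (R.leg₁ k) := by
  have hL := hB.length_le
  have hd := hB.val_sub_pos
  have hdn := ZMod.val_lt (l - k)
  ext S
  simp only [sharedSegments, Finset.mem_inter, Finset.mem_image, Finset.mem_range,
    Finset.mem_filter]
  constructor
  · rintro ⟨⟨i, hi, rfl⟩, j, hj, h⟩
    -- The case `i = n` arises only for `L = n + 1`, where the first leg ends on its own first
    -- segment.
    rcases (show i < n ∨ i = n by omega) with hin | rfl
    · refine ⟨i, ⟨by omega, ?_⟩, rfl⟩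
      by_contra! hcon
      have hmod := (R.leg₁_eq_leg₂_plusPlus_iff k l i j).1 h.symm
      have hlt : i < (l - k).val + j := by omega
      have hdvd := Nat.le_of_dvd (by omega) ((Nat.modEq_iff_dvd' hlt.le).1 hmod)
      omega
    · exact ⟨0, ⟨by omega, by omega⟩, (R.leg₁_add_period k 0).symm⟩
  · rintro ⟨i, ⟨hi, h⟩, rfl⟩
    refine ⟨⟨i, by omega, rfl⟩, ?_⟩
    rcases h with h | h
    · refine ⟨i - (l - k).val, by omega, ?_⟩
      rw [← R.leg₁_val_add k l, Nat.add_sub_cancel' h]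
    · exact ⟨n - (l - k).val + i, by omega, (R.leg₁_eq_leg₂_sub_val_add k l i).symm⟩

theorem leg₁_mem_sharedSegments (hB : R.IsCombinatorialBigon .plusPlus k l L) {i : ℕ}
    (hi : i < min L n) (h : (l - k).val ≤ i ∨ i < L + (l - k).val - n) :
    R.leg₁ k i ∈ R.sharedSegments .plusPlus k l L := by
  rw [hB.sharedSegments_plusPlus]
  exact Finset.mem_image_of_mem _ (Finset.mem_filter.2 ⟨Finset.mem_range.2 hi, h⟩)

/-- The cap `n` matters only for `L = n + 1`: the two overlaps then add up to `n + 2`, with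
repetitions. -/
theorem card_sharedSegments_plusPlus (hB : R.IsCombinatorialBigon .plusPlus k l L) :
    (R.sharedSegments .plusPlus k l L).card =
      min n ((L - (l - k).val) + (L + (l - k).val - n)) := by
  have hL := hB.length_le
  have hd := hB.val_sub_pos
  have hdn := ZMod.val_lt (l - k)
  rw [hB.sharedSegments_plusPlus, Finset.card_image_of_injOn]
  · have hset : ((Finset.range (min L n)).filter
        fun i => (l - k).val ≤ i ∨ i < L + (l - k).val - n) =
        Finset.range (min n (L + (l - k).val - n)) ∪
          Finset.Ico (max (l - k).val (L + (l - k).val - n)) (min L n) := by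
      ext i
      simp only [Finset.mem_filter, Finset.mem_range, Finset.mem_union, Finset.mem_Ico]
      omega
    rw [hset, Finset.card_union_of_disjoint, Finset.card_range, Nat.card_Ico]
    · omega
    · refine Finset.disjoint_left.2 fun i hi hi' => ?_
      simp only [Finset.mem_range, Finset.mem_Ico] at hi hi'
      omega
  · refine (R.leg₁_injOn k).mono fun i hi => ?_
    have := (Finset.mem_filter.1 hi).1
    simp only [Finset.mem_range] at this
    exact lt_of_lt_of_le this (min_le_right _ _)

theorem sharedSegments_eq_pair (hB : R.IsCombinatorialBigon .plusPlus k l L)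
    (hcard : (R.sharedSegments .plusPlus k l L).card = 2) {i j : ℕ} (hij : i ≠ j)
    (hi : i < min L n) (hi' : (l - k).val ≤ i ∨ i < L + (l - k).val - n)
    (hj : j < min L n) (hj' : (l - k).val ≤ j ∨ j < L + (l - k).val - n) :
    R.sharedSegments .plusPlus k l L = {R.leg₁ k i, R.leg₁ k j} := by
  have hne : R.leg₁ k i ≠ R.leg₁ k j := fun h =>
    hij (R.leg₁_injOn k (lt_of_lt_of_le hi (min_le_right _ _))
      (lt_of_lt_of_le hj (min_le_right _ _)) h)
  refine (Finset.eq_of_subset_of_card_le ?_ ?_).symm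
  · intro S hS
    rcases Finset.mem_insert.1 hS with rfl | hS
    · exact hB.leg₁_mem_sharedSegments hi hi'
    · rw [Finset.mem_singleton.1 hS]
      exact hB.leg₁_mem_sharedSegments hj hj'
  · rw [hcard, Finset.card_pair hne]

/-- If the bigon runs once around the curve, the offset of its legs is not half the length of the
curve, for then the pair of segments at that offset is the initial pair in the other order. -/
theorem length_ne_succ_of_two_mul_val (hB : R.IsCombinatorialBigon .plusPlus k l L)
    (h : 2 * (l - k).val = n) : L ≠ n + 1 := by
  intro hL
  have hd := hB.val_sub_pos
  have h1 := R.leg₁_val_add k l 0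
  have h2 := R.leg₁_eq_leg₂_sub_val_add k l 0
  rw [add_zero] at h1
  rw [add_zero, show n - (l - k).val = (l - k).val by omega] at h2
  refine hB.not_intersects (l - k).val hd (by omega) ?_
  rw [h1, ← h2]
  exact hB.first_intersects.symm

end IsCombinatorialBigon

end Basic

end SegmentedRep

theorem mainTheorem5 {α : Type*} [DecidableEq α] {n : ℕ} [NeZero n] (X : SurfaceWord α)
    (w : ReducedCyclicWord α n) (R : SegmentedRep X w) (o : BigonOrientation) (k l : ZMod n)
    (L : ℕ) (hB : R.IsCombinatorialBigon o k l L) :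
    -- (a) exactly one shared segment
    (∀ S, R.sharedSegments o k l L = {S} →
      (S = R.leg₁ k 0 ∧ S = R.leg₂ o l (L - 1)) ∨
      (S = R.leg₁ k (L - 1) ∧ S = R.leg₂ o l 0)) ∧
    -- (b) exactly two shared segments
    ((R.sharedSegments o k l L).card = 2 →
      (R.sharedSegments o k l L = {R.leg₁ k 0, R.leg₁ k 1} ∧
        R.leg₁ k 0 = R.leg₂ o l (L - 2) ∧ R.leg₁ k 1 = R.leg₂ o l (L - 1)) ∨
      (R.sharedSegments o k l L = {R.leg₂ o l 0, R.leg₂ o l 1} ∧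
        R.leg₂ o l 0 = R.leg₁ k (L - 2) ∧ R.leg₂ o l 1 = R.leg₁ k (L - 1)) ∨
      (R.sharedSegments o k l L = {R.leg₁ k 0, R.leg₁ k (L - 1)} ∧
        R.leg₁ k 0 = R.leg₂ o l (L - 1) ∧ R.leg₁ k (L - 1) = R.leg₂ o l 0)) ∧
    -- (c) at least three shared segments
    (3 ≤ (R.sharedSegments o k l L).card →
      ∃ r, 2 ≤ r ∧ r ≤ L ∧
        ((∀ m < r, R.leg₁ k m = R.leg₂ o l (L - r + m)) ∨
         (∀ m < r, R.leg₂ o l m = R.leg₁ k (L - r + m)))) := by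
  cases o with
  | plusMinus =>
    rw [hB.sharedSegments_plusMinus]
    refine ⟨fun S hS => ?_, fun h => ?_, fun h => ?_⟩
    · exact absurd hS.symm (Finset.singleton_ne_empty S)
    · simp at h
    · simp at h
  | plusPlus =>
    have hL := hB.length_le
    have hL2 := hB.two_le
    have hd := hB.val_sub_pos
    have hdn := ZMod.val_lt (l - k)
    have hcard := hB.card_sharedSegments_plusPlus
    have hfwd := R.leg₁_val_add k l
    have hbwd := R.leg₁_eq_leg₂_sub_val_add k l
    have hhalf := hB.length_ne_succ_of_two_mul_val
    have hmem : ∀ i, i < min L n → ((l - k).val ≤ i ∨ i < L + (l - k).val - n) →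
        R.leg₁ k i ∈ R.sharedSegments .plusPlus k l L :=
      fun i => hB.leg₁_mem_sharedSegments
    have hpair := fun h (i j : ℕ) => hB.sharedSegments_eq_pair h (i := i) (j := j)
    generalize (l - k).val = d at *
    refine ⟨fun S hS => ?_, fun h => ?_, fun h => ?_⟩
    · rw [hS, Finset.card_singleton] at hcard
      rcases (show L = d + 1 ∨ L + d = n + 1 by omega) with h | h
      · right
        have hm := hmem (L - 1) (by omega) (by omega)
        rw [hS, Finset.mem_singleton] at hm
        refine ⟨hm.symm, ?_⟩
        rw [← hm, ← hfwd 0]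
        congr 1
        omega
      · left
        have hm := hmem 0 (by omega) (by omega)
        rw [hS, Finset.mem_singleton] at hm
        refine ⟨hm.symm, ?_⟩
        rw [← hm, hbwd 0]
        congr 1
        omega
    · rw [h] at hcard
      -- If `L = n + 1`, the cap forces `n = 2` and `d = 1`, the half-period offset excluded by
      -- `hhalf`.
      have hLn : L ≤ n := by
        by_contra hcon
        exact hhalf (by omega) (by omega)
      -- The overlap lengths `L + d - n` and `L - d` sum to 2: as 2 + 0, 0 + 2 or 1 + 1.
      rcases (show L + d = n + 2 ∨ L = d + 2 ∨ (L = d + 1 ∧ L + d = n + 1) by omega) with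
        h' | h' | ⟨h', h''⟩
      · left
        refine ⟨hpair h 0 1 (by omega) (by omega) (by omega) (by omega) (by omega), ?_, ?_⟩
        · rw [hbwd 0]
          congr 1
          omega
        · rw [hbwd 1]
          congr 1
          omega
      · right; left
        rw [← hfwd 0, ← hfwd 1]
        refine ⟨hpair h _ _ (by omega) (by omega) (by omega) (by omega) (by omega), ?_, ?_⟩
        · congr 1
          omega
        · congr 1
          omega
      · right; right
        refine ⟨hpair h _ _ (by omega) (by omega) (by omega) (by omega) (by omega), ?_, ?_⟩
        · rw [hbwd 0]
          congr 1
          omega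
        · rw [← hfwd 0]
          congr 1
          omega
    · rw [hcard] at h
      -- Two overlap lengths with sum at least 3 cannot both be below 2; the larger overlap supplies
      -- `r`.
      rcases (show 2 ≤ L - d ∨ 2 ≤ L + d - n by omega) with h' | h'
      · refine ⟨L - d, h', by omega, Or.inr fun m _ => ?_⟩
        rw [← hfwd m]
        congr 1
        omega
      · refine ⟨L + d - n, h', by omega, Or.inl fun m _ => ?_⟩
        rw [hbwd m]
        congr 1
        omega
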